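/- Let $K$ be a field, let $T=K[x_{11},\ldots,x_{1m_1},x_{21},\ldots,x_{2m_2}]$ with $m_1,m_2>1$, and let $2\le d\le 2m_1+2m_2-1$. For $i=1,2$ and $h\ge 1$ let $I_{ih}\subset K[x_{i1},\ldots,x_{im_i}]$ be the ideal generated by all monomials $x_{i1}^{a_1}\cdots x_{im_i}^{a_{m_i}}$ with $\sum_j a_j=h$ and $0\le a_j\le 2$ for all $j$. Put \[ L=\sum_{\substack{1\le h_i\le 2m_i\\ h_1+h_2=d}} I_{1h_1}I_{2h_2}\subset T,\qquad I=\bigl(x_1^{h_1}x_2^{h_2} : 1\le h_i\le 2m_i,\ h_1+h_2=d\bigr)\subset K[x_1,x_2]. \] Then for every $k\ge 1$: (a) $L^k$ has a $kd$-linear resolution, i.e. a graded free resolution $0\to T(-kd-N)^{\beta_N}\to\cdots\to T(-kd-1)^{\beta_1}\to T(-kd)^{\beta_0}\to L^k\to 0$ (whose maps are therefore given by matrices with entries zero or linear forms). (b) $L^k$ is a generalized mixed product ideal induced by $I^k$: for $i=1,2$ there are monomial ideals $L_{i,c(i)}\subset K[x_{i1},\ldots,x_{im_i}]$, indexed by the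 exponents $c(i)$ of $x_i$ in the minimal monomial generators $x_1^{c(1)}x_2^{c(2)}$ of $I^k$, such that $L_{i,c(i)}\subset L_{i,c'(i)}$ whenever $c(i)\ge c'(i)$, and \[ L^k=\sum_{x_1^{c(1)}x_2^{c(2)}\in G(I^k)} L_{1,c(1)}L_{2,c(2)}, \] where $G(I^k)$ is the set of minimal monomial generators of $I^k$. Moreover these ideals may be chosen such that for each $x^{c}\in G(I^k)$ there are minimal generators $x^{a_1},\ldots,x^{a_k}$ of $I$ with $a_1+\cdots+a_k=c$ and $L_{i,c(i)}=\prod_{l=1}^k I_{i,a_l(i)}$ for $i=1,2$. -/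

import Mathlib

noncomputable section

/-- An ideal `J` of a polynomial ring has a `d`-linear resolution: there is an exact complex
`0 → T(-d-N)^{β N} → ⋯ → T(-d-1)^{β 1} → T(-d)^{β 0} → J → 0` of finite free graded modules.
The map `T^{β 0} → J` sends the basis to generators of `J` that are homogeneous of degree `d`, and
every other map is given by a matrix all of whose entries are homogeneous of degree `1` (possibly
zero); in particular such a resolution is the minimal graded free resolution of `J`. -/
def HasLinearResolution {K σ : Type*} [Field K] (d : ℕ) (J : Ideal (MvPolynomial σ K)) : Prop :=
  ∃ (β : ℕ → ℕ) (f : Fin (β 0) → MvPolynomial σ K)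
    (A : ∀ p : ℕ, Matrix (Fin (β p)) (Fin (β (p + 1))) (MvPolynomial σ K)),
    (∃ N, ∀ p, N < p → β p = 0) ∧
    (∀ s, (f s).IsHomogeneous d) ∧
    (∀ p s t, (A p s t).IsHomogeneous 1) ∧
    Ideal.span (Set.range f) = J ∧
    Function.Exact (A 0).mulVecLin (Fintype.linearCombination (MvPolynomial σ K) f) ∧
    ∀ p, Function.Exact (A (p + 1)).mulVecLin (A p).mulVecLin

/-- The ideal generated by the monomials with exponent vector in `S`. -/
def monomialSpan (K : Type*) {σ : Type*} [Field K] (S : Set (σ →₀ ℕ)) :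
    Ideal (MvPolynomial σ K) :=
  Ideal.span ((fun a => MvPolynomial.monomial a (1 : K)) '' S)

/-- Monomial ideals: ideals generated by monomials. -/
def IsMonomialIdeal {K σ : Type*} [Field K] (J : Ideal (MvPolynomial σ K)) : Prop :=
  ∃ S : Set (σ →₀ ℕ), J = monomialSpan K S

/-- The exponent vectors of the minimal monomial generators `G(J)` of a monomial ideal `J`. -/
def minimalExponents {K σ : Type*} [Field K] (J : Ideal (MvPolynomial σ K)) : Set (σ →₀ ℕ) :=
  {a | Minimal (fun b => MvPolynomial.monomial b (1 : K) ∈ J) a}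

/-- The ideal of `K[x_1, …, x_m]` generated by the monomials of degree `h` all of whose exponents
are at most `r`. -/
def veroneseType (K : Type*) [Field K] (m r h : ℕ) : Ideal (MvPolynomial (Fin m) K) :=
  monomialSpan K {a : Fin m →₀ ℕ | ∑ j, a j = h ∧ ∀ j, a j ≤ r}

/-- The extension to `T = K[x_{ij} : i ∈ Fin n, j ∈ Fin (m i)]` of an ideal of
`T_i = K[x_{ij} : j ∈ Fin (m i)]`. -/
def extendBlock {K : Type*} [Field K] {n : ℕ} (m : Fin n → ℕ) (i : Fin n)
    (J : Ideal (MvPolynomial (Fin (m i)) K)) : Ideal (MvPolynomial ((i : Fin n) × Fin (m i)) K) :=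
  J.map (MvPolynomial.rename (R := K)
    (fun j => ⟨i, j⟩ : Fin (m i) → (i : Fin n) × Fin (m i)))

/-- `L` is the generalized mixed product ideal induced by the monomial ideal `I ⊂ K[x_1, …, x_n]`
and the family of monomial ideals `F i h ⊂ K[x_{i1}, …, x_{i m_i}]`, where only those `h` matter that
occur as the exponent of `x_i` in a minimal generator of `I`. -/
structure IsGeneralizedMixedProduct {K : Type*} [Field K] {n : ℕ} (m : Fin n → ℕ)
    (I : Ideal (MvPolynomial (Fin n) K)) (F : ∀ i : Fin n, ℕ → Ideal (MvPolynomial (Fin (m i)) K))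
    (L : Ideal (MvPolynomial ((i : Fin n) × Fin (m i)) K)) : Prop where
  isMonomialIdeal : IsMonomialIdeal I
  ne_top : I ≠ ⊤
  family_isMonomialIdeal : ∀ a ∈ minimalExponents I, ∀ i, IsMonomialIdeal (F i (a i))
  family_anti : ∀ a ∈ minimalExponents I, ∀ b ∈ minimalExponents I, ∀ i,
    b i ≤ a i → F i (a i) ≤ F i (b i)
  eq_sum : L = ⨆ a ∈ minimalExponents I, ∏ i, extendBlock m i (F i (a i))

/-- The pairs `(h_1, h_2)` with `1 ≤ h_i ≤ 2 m_i` and `h_1 + h_2 = d`. -/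
def degreePairs (m : Fin 2 → ℕ) (d : ℕ) : Set (Fin 2 →₀ ℕ) :=
  {h | (∀ i, 1 ≤ h i ∧ h i ≤ 2 * m i) ∧ h 0 + h 1 = d}

/-- `I = (x_1^{h_1} x_2^{h_2} : 1 ≤ h_i ≤ 2 m_i, h_1 + h_2 = d) ⊂ K[x_1, x_2]`. -/
def inducingIdeal (K : Type*) [Field K] (m : Fin 2 → ℕ) (d : ℕ) : Ideal (MvPolynomial (Fin 2) K) :=
  monomialSpan K (degreePairs m d)

/-- `L = ∑ I_{1 h_1} I_{2 h_2}`, the sum over `1 ≤ h_i ≤ 2 m_i`, `h_1 + h_2 = d`, where `I_{i h}` is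
generated by the monomials of degree `h` in `x_{i1}, …, x_{i m_i}` with all exponents at most `2`. -/
def veroneseMixedIdeal (K : Type*) [Field K] (m : Fin 2 → ℕ) (d : ℕ) :
    Ideal (MvPolynomial ((i : Fin 2) × Fin (m i)) K) :=
  ⨆ h ∈ degreePairs m d,
    extendBlock m 0 (veroneseType K (m 0) 2 (h 0)) * extendBlock m 1 (veroneseType K (m 1) 2 (h 1))

end

/-! Both claims reduce to combinatorics of exponent vectors. List the factors of a monomial with
exponents at most `2k` variable by variable, block 1 before block 2, and deal them cyclically to `k`
players. Nobody receives a variable more than twice, each share of a block is the floor or ceiling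
of a `k`-th of its degree, and when the total degree is `kd` everybody holds exactly `d` factors. So
the Veronese type ideals with bound `2k` are products of ones with bound `2`, and the shares of the
two blocks match up to generators of `I` (`veroneseType_eq_prod`, `balancedPair_mem`). This gives
(b), with bound `2k` ideals as the family.

Consequently `L^k` is generated by the monomials of degree `kd` with exponents at most `2k` and both
block degrees at least `k`. These satisfy the exchange property of discrete polymatroids
(`powerVectors_exchange`), so in lexicographic order every successive colon ideal is generated by
variables, and iterated mapping cones (`HasLinearSyzygies.cone`) build a linear resolution. -/

open MvPolynomial in
/-- The kernel of a matrix `A` over a polynomial ring has a linear free resolution of length at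
most `N`: there is an exact complex `⋯ → T^{n''} → T^{n'} → T^n` ending in `A` whose other matrices
have entries homogeneous of degree one and whose `N`-th matrix (counted from `A`) is injective. -/
def HasLinearSyzygies {K σ : Type*} [Field K] :
    ℕ → ∀ {m n : Type} [Fintype n], Matrix m n (MvPolynomial σ K) → Prop
  | 0, _, _, _, A => Function.Injective A.mulVec
  | N + 1, _, n, _, A => ∃ (n' : Type) (_ : Fintype n') (B : Matrix n n' (MvPolynomial σ K)),
      (∀ s t, (B s t).IsHomogeneous 1) ∧ Function.Exact B.mulVec A.mulVec ∧ HasLinearSyzygies N B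

/-! ### Linear lifts through homogeneous matrices -/

section Homogeneous

variable {K σ : Type*} [Field K]

open MvPolynomial

theorem homogeneousComponent_mul_of_left {a : MvPolynomial σ K} {e : ℕ} (ha : a.IsHomogeneous e)
    (b : MvPolynomial σ K) (i : ℕ) :
    homogeneousComponent (e + i) (a * b) = a * homogeneousComponent i b := by
  letI : GradedAlgebra (homogeneousSubmodule σ K) := gradedAlgebra
  have h := DirectSum.coe_decompose_mul_add_of_left_mem (homogeneousSubmodule σ K) (i := e) (j := i)
    (a := a) (b := b) ((mem_homogeneousSubmodule e a).2 ha)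
  exact (decomposition.decompose'_apply _ _).symm.trans
    (h.trans (congrArg (a * ·) (decomposition.decompose'_apply _ _)))

/-- A matrix with homogeneous entries of degree `e` maps onto homogeneous vectors of degree `e + 1`
in its range already from the vectors with linear entries. -/
theorem exists_linear_mulVec_eq {m n : Type*} [Fintype n] {A : Matrix m n (MvPolynomial σ K)}
    {e : ℕ} (hA : ∀ s t, (A s t).IsHomogeneous e) {w : m → MvPolynomial σ K}
    (hw : ∀ s, (w s).IsHomogeneous (e + 1)) (h : ∃ v, A.mulVec v = w) :
    ∃ v, (∀ t, (v t).IsHomogeneous 1) ∧ A.mulVec v = w := by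
  obtain ⟨v, rfl⟩ := h
  refine ⟨fun t => homogeneousComponent 1 (v t), fun t => homogeneousComponent_isHomogeneous _ _,
    funext fun s => ?_⟩
  rw [← homogeneousComponent_eq_self (hw s)]
  simp only [Matrix.mulVec, dotProduct, map_sum]
  exact Finset.sum_congr rfl fun t _ => (homogeneousComponent_mul_of_left (hA s t) _ _).symm

/-- Columnwise version of `exists_linear_mulVec_eq`. -/
theorem exists_linear_mul_eq {m n p : Type*} [Fintype n] [Fintype p]
    {A : Matrix m n (MvPolynomial σ K)}
    {e : ℕ} (hA : ∀ s t, (A s t).IsHomogeneous e) {W : Matrix m p (MvPolynomial σ K)}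
    (hW : ∀ s t, (W s t).IsHomogeneous (e + 1)) (h : ∀ t, ∃ v, A.mulVec v = W.col t) :
    ∃ V : Matrix n p (MvPolynomial σ K), (∀ s t, (V s t).IsHomogeneous 1) ∧ A * V = W := by
  choose v hv hv' using fun t => exists_linear_mulVec_eq hA (w := W.col t) (fun s => hW s t) (h t)
  refine ⟨Matrix.of fun s t => v t s, fun s t => hv t s, ?_⟩
  ext1 s t
  exact congrFun (hv' t) s

theorem isHomogeneous_matrix_mul {m n p : Type*} [Fintype n]
    {A : Matrix m n (MvPolynomial σ K)} {B : Matrix n p (MvPolynomial σ K)} {e e' : ℕ}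
    (hA : ∀ s t, (A s t).IsHomogeneous e) (hB : ∀ s t, (B s t).IsHomogeneous e') (s : m) (t : p) :
    ((A * B) s t).IsHomogeneous (e + e') := by
  rw [Matrix.mul_apply]
  exact IsHomogeneous.sum _ _ _ fun i _ => (hA s i).mul (hB i t)

end Homogeneous

/-! ### Horseshoe lemma and mapping cone -/

namespace HasLinearSyzygies

variable {K σ : Type*} [Field K]

open MvPolynomial

/-- Resolutions can be padded by zero modules; this brings two of them to a common length before
they are glued. -/
theorem succ : ∀ {N : ℕ} {m n : Type} [Fintype n] {A : Matrix m n (MvPolynomial σ K)},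
    HasLinearSyzygies N A → HasLinearSyzygies (N + 1) A
  | 0, m, n, _, A, h => by
    refine ⟨Empty, inferInstance, 0, fun s t => t.elim, fun v => ?_,
      Function.injective_of_subsingleton _⟩
    have h0 : A.mulVec 0 = 0 := Matrix.mulVec_zero A
    constructor
    · intro hv
      exact ⟨0, by rw [Matrix.mulVec_zero]; exact (h (hv.trans h0.symm)).symm⟩
    · rintro ⟨w, rfl⟩
      rw [Matrix.zero_mulVec, h0]
  | N + 1, m, n, _, A, ⟨n', _, B, hB, hex, h⟩ => ⟨n', _, B, hB, hex, h.succ⟩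

theorem mono {N N' : ℕ} (hN : N ≤ N') {m n : Type} [Fintype n] {A : Matrix m n (MvPolynomial σ K)}
    (h : HasLinearSyzygies N A) : HasLinearSyzygies N' A := by
  induction hN with
  | refl => exact h
  | step _ ih => exact ih.succ

/-- The horseshoe lemma for linear resolutions. -/
theorem fromBlocks : ∀ {N : ℕ} {m' n' m'' n'' : Type} [Fintype n'] [Fintype n'']
    {A' : Matrix m' n' (MvPolynomial σ K)} {A'' : Matrix m'' n'' (MvPolynomial σ K)}
    {C : Matrix m' n'' (MvPolynomial σ K)},
    (∀ s t, (A' s t).IsHomogeneous 1) → (∀ s t, (C s t).IsHomogeneous 1) →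
    (∀ w, A''.mulVec w = 0 → ∃ v, A'.mulVec v = C.mulVec w) →
    HasLinearSyzygies N A' → HasLinearSyzygies N A'' →
    HasLinearSyzygies N (Matrix.fromBlocks A' C 0 A'')
  | 0, m', n', m'', n'', _, _, A', A'', C, _, _, _, h', h'' => by
    intro v w hvw
    simp only [Matrix.fromBlocks_mulVec, Matrix.zero_mulVec, zero_add] at hvw
    have h1 := h'' (congrArg (· ∘ Sum.inr) hvw)
    have h2 := congrArg (· ∘ Sum.inl) hvw
    simp only [Sum.elim_comp_inl, h1, add_left_inj] at h2
    have h3 := h' h2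
    rw [← Sum.elim_comp_inl_inr v, ← Sum.elim_comp_inl_inr w, h1, h3]
  | N + 1, m', n', m'', n'', _, _, A', A'', C, hA', hC, hlift,
      ⟨p', _, B', hB', hex', h'⟩, ⟨p'', _, B'', hB'', hex'', h''⟩ => by
    -- The connecting block must satisfy `A' * C' = -(C * B'')`. The right side has degree 2, so a
    -- lift of its columns can be chosen linear.
    obtain ⟨C', hC', hC'A⟩ := exists_linear_mul_eq (e := 1) hA' (W := -(C * B''))
      (fun s t => (isHomogeneous_matrix_mul hC hB'' s t).neg) (fun t => by
        classical
        obtain ⟨v, hv⟩ := hlift (B''.mulVec (Pi.single t 1)) (hex''.apply_apply_eq_zero _)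
        refine ⟨-v, ?_⟩
        rw [Matrix.mulVec_neg, hv, Matrix.mulVec_mulVec, Matrix.mulVec_single_one]
        rfl)
    have hcomp (w) : A'.mulVec (C'.mulVec w) = -C.mulVec (B''.mulVec w) := by
      rw [Matrix.mulVec_mulVec, hC'A, Matrix.neg_mulVec, Matrix.mulVec_mulVec]
    refine ⟨p' ⊕ p'', inferInstance, Matrix.fromBlocks B' C' 0 B'', ?_, fun v => ⟨?_, ?_⟩,
      fromBlocks hB' hC' (fun w hw => ?_) h' h''⟩
    · rintro (s | s) (t | t)
      · exact hB' s t
      · exact hC' s t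
      · exact isHomogeneous_zero _ _ _
      · exact hB'' s t
    · intro hv
      simp only [Matrix.fromBlocks_mulVec, Matrix.zero_mulVec, zero_add] at hv
      have h1 : A''.mulVec (v ∘ Sum.inr) = 0 := congrArg (· ∘ Sum.inr) hv
      have h2 : A'.mulVec (v ∘ Sum.inl) + C.mulVec (v ∘ Sum.inr) = 0 :=
        congrArg (· ∘ Sum.inl) hv
      obtain ⟨w, hw⟩ := (hex'' _).1 h1
      obtain ⟨x, hx⟩ := (hex' (v ∘ Sum.inl - C'.mulVec w)).1 (by
        rw [Matrix.mulVec_sub, hcomp, hw, sub_neg_eq_add, h2])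
      refine ⟨Sum.elim x w, ?_⟩
      rw [Matrix.fromBlocks_mulVec]
      simp only [Sum.elim_comp_inl, Sum.elim_comp_inr, Matrix.zero_mulVec, zero_add, hx, hw,
        sub_add_cancel, Sum.elim_comp_inl_inr]
    · rintro ⟨w, rfl⟩
      simp only [Matrix.fromBlocks_mulVec, Sum.elim_comp_inl, Sum.elim_comp_inr,
        Matrix.zero_mulVec, zero_add, Matrix.mulVec_add, hcomp, hex'.apply_apply_eq_zero,
        hex''.apply_apply_eq_zero, neg_add_cancel]
      exact Sum.elim_zero_zero
    · exact (hex' _).1 (by rw [hcomp, hw, Matrix.mulVec_zero, neg_zero])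

/-- Mapping cone: if `f` generates an ideal with linear syzygies and the colon ideal of `u` by it is
generated by linear forms `g` with linear syzygies, then `f` and `u` together have linear
syzygies. -/
theorem cone {N : ℕ} {n' n'' : Type} [Fintype n'] [Fintype n''] {f : n' → MvPolynomial σ K}
    {g : n'' → MvPolynomial σ K} {u : MvPolynomial σ K} {e : ℕ}
    (hf : ∀ s, (f s).IsHomogeneous e) (hu : u.IsHomogeneous e) (hg : ∀ s, (g s).IsHomogeneous 1)
    (hcolon : ∀ c, c * u ∈ Ideal.span (Set.range f) ↔ c ∈ Ideal.span (Set.range g))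
    (h' : HasLinearSyzygies (N + 1) (Matrix.replicateRow Unit f))
    (h'' : HasLinearSyzygies N (Matrix.replicateRow Unit g)) :
    HasLinearSyzygies (N + 1) (Matrix.replicateRow Unit (Sum.elim f fun _ : Unit => u)) := by
  obtain ⟨p, _, B, hB, hex, h'⟩ := h'
  have hspan {n : Type} [Fintype n] (k : n → MvPolynomial σ K) (c : MvPolynomial σ K) :
      c ∈ Ideal.span (Set.range k) ↔
        ∃ v, (Matrix.replicateRow Unit k).mulVec v = fun _ => c := by
    rw [Ideal.mem_span_range_iff_exists_fun]
    refine exists_congr fun v => ⟨fun h => funext fun _ => ?_, fun h => ?_⟩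
    · rw [← h]; exact Finset.sum_congr rfl fun i _ => mul_comm _ _
    · rw [← congrFun h ()]; exact Finset.sum_congr rfl fun i _ => mul_comm _ _
  -- Each `g t * u` lies in the ideal of `f`; `C` records these relations. The last coordinate of a
  -- syzygy of `(f, u)` lies in the colon ideal, hence the block matrix below generates all
  -- syzygies.
  obtain ⟨C, hC, hfC⟩ := exists_linear_mul_eq (A := Matrix.replicateRow Unit f) (e := e)
    (fun _ t => hf t) (W := Matrix.replicateRow Unit fun t => -(g t * u))
    (fun _ t => by simpa only [Matrix.replicateRow_apply, add_comm] using ((hg t).mul hu).neg)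
    (fun t => (hspan f _).1 (neg_mem ((hcolon _).2 (Ideal.subset_span ⟨t, rfl⟩))))
  have hcomp (w) : (Matrix.replicateRow Unit f).mulVec (C.mulVec w) =
      -fun x => (Matrix.replicateRow Unit g).mulVec w x * u := by
    rw [Matrix.mulVec_mulVec, hfC]
    ext1 x
    simp only [Matrix.mulVec, dotProduct, Matrix.replicateRow_apply, Pi.neg_apply,
      Finset.sum_mul, ← Finset.sum_neg_distrib]
    exact Finset.sum_congr rfl fun t _ => by ring
  have hrow (v : n' ⊕ Unit → MvPolynomial σ K) :
      (Matrix.replicateRow Unit (Sum.elim f fun _ : Unit => u)).mulVec v =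
        (Matrix.replicateRow Unit f).mulVec (v ∘ Sum.inl) + fun _ => v (Sum.inr ()) * u := by
    ext1 x
    simp [Matrix.mulVec, dotProduct, mul_comm]
  refine ⟨p ⊕ n'', inferInstance, Matrix.fromBlocks B C 0 (Matrix.replicateRow Unit g), ?_,
    fun v => ?_, fromBlocks hB hC (fun w hw => ?_) h' h''⟩
  · rintro (s | s) (t | t)
    · exact hB s t
    · exact hC s t
    · exact isHomogeneous_zero _ _ _
    · exact hg t
  · rw [hrow]
    constructor
    · intro hv
      have hmem : v (Sum.inr ()) ∈ Ideal.span (Set.range g) := by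
        refine (hcolon _).1 ((hspan f _).2 ⟨-(v ∘ Sum.inl), ?_⟩)
        rw [Matrix.mulVec_neg, neg_eq_iff_add_eq_zero]
        exact hv
      obtain ⟨w, hw⟩ := (hspan g _).1 hmem
      obtain ⟨x, hx⟩ := (hex (v ∘ Sum.inl - C.mulVec w)).1 (by
        rw [Matrix.mulVec_sub, hcomp, hw, sub_neg_eq_add, hv])
      refine ⟨Sum.elim x w, ?_⟩
      rw [Matrix.fromBlocks_mulVec]
      simp only [Sum.elim_comp_inl, Sum.elim_comp_inr, Matrix.zero_mulVec, zero_add, hx, hw,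
        sub_add_cancel]
      exact Sum.elim_comp_inl_inr v
    · rintro ⟨w, rfl⟩
      rw [Matrix.fromBlocks_mulVec]
      simp only [Sum.elim_comp_inl, Sum.elim_inr, Matrix.mulVec_add,
        hex.apply_apply_eq_zero, zero_add, hcomp, Matrix.zero_mulVec]
      exact neg_add_cancel _
  · refine (hex _).1 ?_
    rw [hcomp, hw]
    ext1 x
    simp

end HasLinearSyzygies

/-- Unrolls the recursive predicate into a sequence of matrices. The bijection `e` is kept so that
consecutive matrices number their common free module alike. -/
theorem HasLinearSyzygies.exists_fin_resolution {K σ : Type*} [Field K] :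
    ∀ {N : ℕ} {m n : Type} [Fintype n] {A : Matrix m n (MvPolynomial σ K)},
    HasLinearSyzygies N A →
    ∃ (β : ℕ → ℕ) (e : Fin (β 0) ≃ n)
      (M : ∀ p : ℕ, Matrix (Fin (β p)) (Fin (β (p + 1))) (MvPolynomial σ K)),
      (∃ N, ∀ p, N < p → β p = 0) ∧ (∀ p s t, (M p s t).IsHomogeneous 1) ∧
      Function.Exact (M 0).mulVec (A.submatrix id e).mulVec ∧
      ∀ p, Function.Exact (M (p + 1)).mulVec (M p).mulVec
  | 0, m, n, _, A, h => by
    refine ⟨fun p => Nat.casesOn p (Fintype.card n) fun _ => 0, (Fintype.equivFin n).symm,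
      fun p => 0, ⟨0, ?_⟩, fun p s t => MvPolynomial.isHomogeneous_zero _ _ _, fun v => ?_,
      fun p v => ?_⟩
    · rintro (_ | p) hp
      · exact absurd hp (lt_irrefl _)
      · rfl
    · have h0 : (A.submatrix id (Fintype.equivFin n).symm).mulVec v =
          A.mulVec (v ∘ Fintype.equivFin n) := by
        have := Matrix.submatrix_mulVec_equiv A v id (Fintype.equivFin n).symm
        simpa using this
      rw [h0]
      constructor
      · intro hv
        have := h (hv.trans (Matrix.mulVec_zero A).symm)
        refine ⟨0, ?_⟩
        rw [Matrix.mulVec_zero]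
        ext1 x
        have h2 := congrFun this ((Fintype.equivFin n).symm x)
        simpa using h2.symm
      · rintro ⟨w, rfl⟩
        rw [Matrix.zero_mulVec]
        exact Matrix.mulVec_zero A
    · simp only [Matrix.zero_mulVec, true_iff]
      exact ⟨0, funext fun x => x.elim0⟩
  | N + 1, m, n, _, A, ⟨n', _, B, hB, hex, h⟩ => by
    obtain ⟨β, e, M, ⟨N', hN'⟩, hM, hex0, hexs⟩ := h.exists_fin_resolution
    let e₀ := (Fintype.equivFin n).symm
    refine ⟨fun p => Nat.casesOn p (Fintype.card n) β, e₀,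
      fun p => Nat.casesOn p (B.submatrix e₀ e) M, ⟨N' + 1, ?_⟩, ?_, fun v => ?_, ?_⟩
    · rintro (_ | p) hp
      · omega
      · exact hN' p (by omega)
    · rintro (_ | p) s t
      · exact hB _ _
      · exact hM p s t
    · have h0 : (A.submatrix id e₀).mulVec v = A.mulVec (v ∘ e₀.symm) :=
        Matrix.submatrix_mulVec_equiv A v id e₀
      have h1 (w) : (B.submatrix e₀ e).mulVec w = B.mulVec (w ∘ e.symm) ∘ e₀ :=
        Matrix.submatrix_mulVec_equiv B w e₀ e
      rw [h0, hex]
      constructor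
      · rintro ⟨w, hw⟩
        refine ⟨w ∘ e, (h1 _).trans ?_⟩
        rw [Function.comp_assoc, e.self_comp_symm, Function.comp_id, hw, Function.comp_assoc,
          e₀.symm_comp_self, Function.comp_id]
      · rintro ⟨w, hw⟩
        refine ⟨w ∘ e.symm, ?_⟩
        rw [← hw]
        erw [h1]
        rw [Function.comp_assoc, e₀.self_comp_symm, Function.comp_id]
    · rintro (_ | p)
      · intro v
        have h1 : (B.submatrix e₀ e).mulVec v = (B.submatrix id e).mulVec v ∘ e₀ := rfl
        refine Iff.trans ?_ (hex0 v)
        change (B.submatrix e₀ e).mulVec v = 0 ↔ _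
        rw [h1]
        constructor
        · intro hv
          ext1 x
          have := congrFun hv (e₀.symm x)
          simpa using this
        · intro hv
          rw [hv]
          rfl
      · exact hexs p

theorem HasLinearSyzygies.hasLinearResolution {K σ : Type*} [Field K] {N d : ℕ} {n : Type}
    [Fintype n] {f : n → MvPolynomial σ K} (hf : ∀ s, (f s).IsHomogeneous d)
    (h : HasLinearSyzygies N (Matrix.replicateRow Unit f)) :
    HasLinearResolution d (Ideal.span (Set.range f)) := by
  obtain ⟨β, e, M, hN, hM, hex0, hex⟩ := h.exists_fin_resolution
  refine ⟨β, f ∘ e, M, hN, fun s => hf _, hM, ?_, fun v => ?_, hex⟩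
  · rw [e.surjective.range_comp]
  · refine Iff.trans ?_ (hex0 v)
    rw [Fintype.linearCombination_apply, funext_iff]
    simp [Matrix.mulVec, dotProduct, mul_comm]

/-! ### Linear quotients -/

section LinearQuotients

variable {K σ : Type*} [Field K]

open MvPolynomial

theorem mem_monomialSpan {S : Set (σ →₀ ℕ)} {p : MvPolynomial σ K} :
    p ∈ monomialSpan K S ↔ ∀ b ∈ p.support, ∃ a ∈ S, a ≤ b :=
  mem_ideal_span_monomial_image

theorem monomial_mem_monomialSpan {S : Set (σ →₀ ℕ)} {b : σ →₀ ℕ} :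
    monomial b (1 : K) ∈ monomialSpan K S ↔ ∃ a ∈ S, a ≤ b := by
  classical
  rw [mem_monomialSpan, support_monomial, if_neg one_ne_zero]
  simp

theorem monomialSpan_insert (S : Set (σ →₀ ℕ)) (a : σ →₀ ℕ) :
    monomialSpan K (insert a S) = monomialSpan K S ⊔ Ideal.span {monomial a 1} := by
  rw [monomialSpan, Set.image_insert_eq, Set.insert_eq, Ideal.span_union, sup_comm]
  rfl

theorem span_range_sumElim_unit {n : Type*} (f : n → MvPolynomial σ K) (u : MvPolynomial σ K) :
    Ideal.span (Set.range (Sum.elim f fun _ : Unit => u)) =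
      Ideal.span (Set.range f) ⊔ Ideal.span {u} := by
  rw [Set.Sum.elim_range, Ideal.span_union, Set.range_const]

theorem isHomogeneous_sumElim_unit {n : Type*} {f : n → MvPolynomial σ K}
    {u : MvPolynomial σ K} {e : ℕ} (hf : ∀ s, (f s).IsHomogeneous e) (hu : u.IsHomogeneous e)
    (s : n ⊕ Unit) : ((Sum.elim f fun _ : Unit => u) s).IsHomogeneous e := by
  cases s
  · exact hf _
  · exact hu

/-- Ideals generated by variables have linear syzygies. -/
theorem exists_hasLinearSyzygies_span_X (V : Finset σ) :
    ∃ (n : Type) (_ : Fintype n) (g : n → MvPolynomial σ K) (N : ℕ),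
      (∀ s, (g s).IsHomogeneous 1) ∧ Ideal.span (Set.range g) = Ideal.span (X '' (V : Set σ)) ∧
      HasLinearSyzygies N (Matrix.replicateRow Unit g) := by
  classical
  induction V using Finset.induction_on with
  | empty =>
    refine ⟨Empty, inferInstance, Empty.elim, 0, fun s => s.elim, ?_,
      Function.injective_of_subsingleton _⟩
    simp
  | insert s V hs ih =>
    obtain ⟨n, _, g, N, hg, hspan, h⟩ := ih
    -- Modulo the variables in `V`, the new variable is a nonzerodivisor, so the colon ideal is
    -- again generated by `g`.
    refine ⟨n ⊕ Unit, inferInstance, Sum.elim g fun _ => X s, N + 1,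
      isHomogeneous_sumElim_unit hg (isHomogeneous_X K s), ?_,
      HasLinearSyzygies.cone hg (isHomogeneous_X K s) hg (fun c => ⟨fun hc => ?_, fun hc =>
        Ideal.mul_mem_right _ _ hc⟩) h.succ h⟩
    · rw [span_range_sumElim_unit, hspan, Finset.coe_insert, Set.image_insert_eq, Set.insert_eq,
        Ideal.span_union, sup_comm]
    · rw [hspan, mem_ideal_span_X_image] at hc ⊢
      intro b hb
      obtain ⟨j, hj, hbj⟩ := hc (b + Finsupp.single s 1) (by
        rw [mem_support_iff, coeff_mul_X]
        exact mem_support_iff.1 hb)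
      refine ⟨j, hj, ?_⟩
      have : s ≠ j := fun h => hs (h ▸ hj)
      simpa [Finsupp.single_apply, this] using hbj

/-- A finite set of exponent vectors has linear quotients with respect to the lexicographic
order. -/
def HasLexLinearQuotients [LinearOrder σ] (S : Finset (σ →₀ ℕ)) : Prop :=
  ∀ a ∈ S, ∀ b ∈ S, toLex b < toLex a → ∃ i j, a j < b j ∧
    ∃ c ∈ S, toLex c < toLex a ∧ c + Finsupp.single i 1 = a + Finsupp.single j 1

/-- An equigenerated monomial ideal with linear quotients has linear syzygies. -/
theorem HasLexLinearQuotients.exists_hasLinearSyzygies [LinearOrder σ] [Finite σ]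
    {S : Finset (σ →₀ ℕ)} {d : ℕ} (hS : HasLexLinearQuotients S) (hd : ∀ a ∈ S, a.degree = d) :
    ∃ (n : Type) (_ : Fintype n) (f : n → MvPolynomial σ K) (N : ℕ),
      (∀ s, (f s).IsHomogeneous d) ∧ Ideal.span (Set.range f) = monomialSpan K (S : Set (σ →₀ ℕ)) ∧
      HasLinearSyzygies N (Matrix.replicateRow Unit f) := by
  classical
  -- The lexicographically largest vector is adjoined last, so the earlier ones are exactly those
  -- below it.
  induction S using Finset.induction_on_max_value (toLex : (σ →₀ ℕ) → Lex (σ →₀ ℕ)) with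
  | empty =>
    refine ⟨Empty, inferInstance, Empty.elim, 0, fun s => s.elim, ?_,
      Function.injective_of_subsingleton _⟩
    simp [monomialSpan]
  | insert a S ha hmax ih =>
    have hlt {c} (hc : c ∈ S) : toLex c < toLex a :=
      lt_of_le_of_ne (hmax c hc) fun h => ha (toLex.injective h ▸ hc)
    obtain ⟨n, _, f, N, hf, hspan, h⟩ := ih (fun x hx b hb hbx => by
      obtain ⟨i, j, hj, c, hc, hcx, h⟩ :=
        hS x (Finset.mem_insert_of_mem hx) b (Finset.mem_insert_of_mem hb) hbx
      refine ⟨i, j, hj, c, (Finset.mem_insert.1 hc).resolve_left ?_, hcx, h⟩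
      rintro rfl
      exact absurd hcx (hmax x hx).not_gt) (fun x hx => hd x (Finset.mem_insert_of_mem hx))
    have hu : (monomial a (1 : K)).IsHomogeneous d :=
      isHomogeneous_monomial _ (hd a (Finset.mem_insert_self _ _))
    let V : Set σ := {j | X j * monomial a (1 : K) ∈ monomialSpan K (S : Set (σ →₀ ℕ))}
    obtain ⟨n', _, g, N', hg, hgspan, hg'⟩ :=
      exists_hasLinearSyzygies_span_X (K := K) (Set.toFinite V).toFinset
    rw [Set.Finite.coe_toFinset] at hgspan
    refine ⟨n ⊕ Unit, inferInstance, Sum.elim f fun _ => monomial a 1, max N N' + 1,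
      isHomogeneous_sumElim_unit hf hu, ?_,
      HasLinearSyzygies.cone hf hu hg (fun c => ?_) (h.mono (by omega)) (hg'.mono (by omega))⟩
    · rw [span_range_sumElim_unit, hspan, Finset.coe_insert, monomialSpan_insert]
    · rw [hspan, hgspan]
      constructor
      · intro hc
        rw [mem_ideal_span_X_image]
        intro x hx
        obtain ⟨b, hb, hbx⟩ := mem_monomialSpan.1 hc (x + a) (by
          rw [mem_support_iff, coeff_mul_monomial, mul_one]
          exact mem_support_iff.1 hx)
        -- Since `a j < b j ≤ x j + a j`, the variable `X j` divides the monomial `x`; and `c`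
        -- divides `X j` times `a`, so `X j` is in the colon ideal.
        obtain ⟨i, j, hj, c, hc, hca, hcij⟩ := hS a (Finset.mem_insert_self _ _) b
          (Finset.mem_insert_of_mem hb) (hlt hb)
        refine ⟨j, ?_, ?_⟩
        · change X j * monomial a (1 : K) ∈ monomialSpan K (S : Set (σ →₀ ℕ))
          rw [X, monomial_mul, one_mul, monomial_mem_monomialSpan]
          refine ⟨c, (Finset.mem_insert.1 hc).resolve_left ?_, ?_⟩
          · rintro rfl
            exact lt_irrefl _ hca
          · rw [add_comm, ← hcij]
            exact le_self_add
        · have := hbx j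
          rw [Finsupp.add_apply] at this
          omega
      · intro hc
        have hle : Ideal.span (X '' V) * Ideal.span {monomial a (1 : K)} ≤
            monomialSpan K (S : Set (σ →₀ ℕ)) := by
          rw [Ideal.span_mul_span', Ideal.span_le]
          rintro _ ⟨_, ⟨j, hj, rfl⟩, _, rfl, rfl⟩
          exact hj
        exact hle (Ideal.mul_mem_mul hc (Ideal.mem_span_singleton_self _))

theorem HasLexLinearQuotients.hasLinearResolution [LinearOrder σ] [Finite σ]
    {S : Finset (σ →₀ ℕ)} {d : ℕ} (hS : HasLexLinearQuotients S) (hd : ∀ a ∈ S, a.degree = d) :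
    HasLinearResolution d (monomialSpan K (S : Set (σ →₀ ℕ))) := by
  obtain ⟨n, _, f, N, hf, hspan, h⟩ := hS.exists_hasLinearSyzygies (K := K) hd
  exact hspan ▸ h.hasLinearResolution hf

/-- The exchange property used for sets of bases of discrete polymatroids gives linear quotients. -/
theorem hasLexLinearQuotients_of_exchange [LinearOrder σ] {S : Finset (σ →₀ ℕ)}
    (h : ∀ a ∈ S, ∀ b ∈ S, ∀ i, b i < a i → ∃ j, a j < b j ∧
      a - Finsupp.single i 1 + Finsupp.single j 1 ∈ S) : HasLexLinearQuotients S := by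
  intro a ha b hb hab
  obtain ⟨i, hi, hbi⟩ := hab
  change ∀ j < i, b j = a j at hi
  change b i < a i at hbi
  obtain ⟨j, hj, hS⟩ := h a ha b hb i hbi
  -- Here `i` is the first place where `a` and `b` differ, with `b i < a i`. A unit moved from `i`
  -- to a later `j` lowers the vector lexicographically.
  have hij : i < j := by
    rcases lt_trichotomy i j with h | h | h
    · exact h
    · subst h; omega
    · have := hi j h; omega
  refine ⟨i, j, hj, _, hS, ⟨i, fun l hl => ?_, ?_⟩, ?_⟩
  · change (a - Finsupp.single i 1 + Finsupp.single j 1 : σ →₀ ℕ) l = a l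
    simp [hl.ne', (hl.trans hij).ne']
  · change (a - Finsupp.single i 1 + Finsupp.single j 1 : σ →₀ ℕ) i < a i
    simp [hij.ne']
    omega
  · rw [add_right_comm, tsub_add_cancel_of_le]
    rw [Finsupp.single_le_iff]
    omega

end LinearQuotients

/-! ### Cyclic dealing -/

section BalancedDecomposition

/-- Hermite's identity: raising `s` by one shifts the window of summands, replacing `s / k` by `(s +
k) / k = s / k + 1`. -/
theorem sum_add_div_eq {k : ℕ} (hk : 0 < k) (s : ℕ) : ∑ l : Fin k, (s + l) / k = s := by
  rw [Fin.sum_univ_eq_sum_range fun l => (s + l) / k]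
  induction s with
  | zero =>
    refine Finset.sum_eq_zero fun l hl => ?_
    rw [zero_add]
    exact Nat.div_eq_of_lt (Finset.mem_range.1 hl)
  | succ s ih =>
    have h1 := Finset.sum_range_succ (fun l => (s + l) / k) k
    rw [Finset.sum_range_succ', ih, Nat.add_div_right _ hk] at h1
    simp only [add_zero] at h1
    have h2 : ∑ l ∈ Finset.range k, (s + 1 + l) / k = ∑ l ∈ Finset.range k, (s + (l + 1)) / k :=
      Finset.sum_congr rfl fun l _ => by rw [add_assoc, add_comm 1 l]
    rw [h2]
    omega

/-- The number of `t` with `s ≤ t < s + c` and `t ≡ - l - 1` modulo `k`. -/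
def balancedPart (k s c l : ℕ) : ℕ := (s + c + l) / k - (s + l) / k

theorem add_div_add_balancedPart (k s c l : ℕ) :
    (s + l) / k + balancedPart k s c l = (s + c + l) / k :=
  Nat.add_sub_of_le (Nat.div_le_div_right (by omega))

theorem balancedPart_add (k s c c' l : ℕ) :
    balancedPart k s (c + c') l = balancedPart k s c l + balancedPart k (s + c) c' l := by
  have h1 := add_div_add_balancedPart k s c l
  have h2 := add_div_add_balancedPart k (s + c) c' l
  have h3 := add_div_add_balancedPart k s (c + c') l
  rw [← add_assoc s c c'] at h3
  omega

theorem sum_balancedPart {k : ℕ} (hk : 0 < k) (s c : ℕ) :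
    ∑ l : Fin k, balancedPart k s c l = c := by
  have h := Finset.sum_congr rfl fun (l : Fin k) (_ : l ∈ Finset.univ) =>
    add_div_add_balancedPart k s c l
  rw [Finset.sum_add_distrib, sum_add_div_eq hk, sum_add_div_eq hk] at h
  omega

/-- A run of `k * r` consecutive integers meets every residue class modulo `k` exactly `r` times. -/
theorem balancedPart_le {k : ℕ} (hk : 0 < k) {c r : ℕ} (h : c ≤ k * r) (s l : ℕ) :
    balancedPart k s c l ≤ r := by
  have h1 : (s + c + l) / k ≤ (s + l + k * r) / k := Nat.div_le_div_right (by omega)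
  rw [Nat.add_mul_div_left _ _ hk] at h1
  have := add_div_add_balancedPart k s c l
  omega

theorem le_balancedPart {k : ℕ} (hk : 0 < k) {c r : ℕ} (h : k * r ≤ c) (s l : ℕ) :
    r ≤ balancedPart k s c l := by
  have h1 : (s + l + k * r) / k ≤ (s + c + l) / k := Nat.div_le_div_right (by omega)
  rw [Nat.add_mul_div_left _ _ hk] at h1
  have := add_div_add_balancedPart k s c l
  omega

/-- A vector with entries at most `k * r` is a sum of `k` vectors with entries at most `r` whose
total degrees are balanced. -/
theorem exists_balanced_decomposition {k : ℕ} (hk : 0 < k) (r : ℕ) :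
    ∀ {n : ℕ} (s : ℕ) (a : Fin n → ℕ), (∀ j, a j ≤ k * r) → ∃ b : Fin k → Fin n → ℕ,
      (∀ l j, b l j ≤ r) ∧ (∀ j, ∑ l, b l j = a j) ∧
      ∀ l, ∑ j, b l j = balancedPart k s (∑ j, a j) l
  | 0, s, a, _ => ⟨fun _ => 0, fun _ j => j.elim0, fun j => j.elim0, fun l => by
      simp [balancedPart]⟩
  | n + 1, s, a, ha => by
    -- Dealing resumes at offset `s + a 0`, where the first variable stopped, so the shares add up
    -- to those of one long run.
    obtain ⟨b, hb, hba, hbs⟩ :=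
      exists_balanced_decomposition hk r (s + a 0) (Fin.tail a) fun j => ha _
    refine ⟨fun l => Fin.cons (balancedPart k s (a 0) l) (b l), fun l j => ?_, fun j => ?_,
      fun l => ?_⟩
    · refine Fin.cases ?_ (fun j => ?_) j
      · exact balancedPart_le hk (ha 0) _ _
      · exact hb l j
    · refine Fin.cases ?_ (fun j => ?_) j
      · exact sum_balancedPart hk s (a 0)
      · exact hba j
    · rw [Fin.sum_univ_succ, Fin.sum_univ_succ, balancedPart_add]
      simp only [Fin.cons_zero, Fin.cons_succ]
      rw [hbs l]
      rfl

end BalancedDecomposition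

/-! ### Products and minimal generators of monomial ideals -/

section MonomialSpan

variable {K σ : Type*} [Field K]

open MvPolynomial

theorem monomialSpan_mono {S S' : Set (σ →₀ ℕ)} (h : S ⊆ S') :
    monomialSpan K S ≤ monomialSpan K S' :=
  Ideal.span_mono (Set.image_mono h)

theorem monomialSpan_mul (S S' : Set (σ →₀ ℕ)) :
    monomialSpan K S * monomialSpan K S' = monomialSpan K (Set.image2 (· + ·) S S') := by
  rw [monomialSpan, monomialSpan, Ideal.span_mul_span', monomialSpan, ← Set.image2_mul,
    Set.image2_image_left, Set.image2_image_right, Set.image_image2]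
  simp only [monomial_mul, one_mul]

theorem monomialSpan_biUnion {ι : Type*} (P : Set ι) (S : ι → Set (σ →₀ ℕ)) :
    monomialSpan K (⋃ h ∈ P, S h) = ⨆ h ∈ P, monomialSpan K (S h) := by
  simp only [monomialSpan, Set.image_iUnion, Ideal.span_iUnion]

/-- The set of all sums with one summand in each `S l`. -/
def sumset {ι : Type*} [Fintype ι] (S : ι → Set (σ →₀ ℕ)) : Set (σ →₀ ℕ) :=
  {c | ∃ a : ι → σ →₀ ℕ, (∀ l, a l ∈ S l) ∧ ∑ l, a l = c}

theorem prod_monomialSpan {ι : Type*} [Fintype ι] (S : ι → Set (σ →₀ ℕ)) :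
    ∏ l, monomialSpan K (S l) = monomialSpan K (sumset S) := by
  simp only [monomialSpan]
  rw [Ideal.prod_span]
  congr 1
  ext p
  rw [Set.mem_fintype_prod]
  constructor
  · rintro ⟨g, hg, rfl⟩
    choose a ha hag using hg
    exact ⟨∑ l, a l, ⟨a, fun l => ha l, rfl⟩, by simp only [monomial_sum_one, hag]⟩
  · rintro ⟨_, ⟨a, ha, rfl⟩, rfl⟩
    exact ⟨fun l => monomial (a l) 1, fun l => ⟨a l, ha l, rfl⟩, (monomial_sum_one _ _).symm⟩

theorem monomialSpan_pow (S : Set (σ →₀ ℕ)) (k : ℕ) :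
    monomialSpan K S ^ k = monomialSpan K (sumset fun _ : Fin k => S) := by
  rw [← prod_monomialSpan, Finset.prod_const, Finset.card_univ, Fintype.card_fin]

theorem eq_of_le_of_degree_eq {a b : σ →₀ ℕ} (h : a ≤ b) (hd : a.degree = b.degree) : a = b := by
  obtain ⟨c, rfl⟩ := le_iff_exists_add.1 h
  rw [map_add, left_eq_add, Finsupp.degree_eq_zero_iff] at hd
  rw [hd, add_zero]

/-- Distinct monomials of equal degree do not divide each other, so no generator is redundant. -/
theorem minimalExponents_monomialSpan {S : Set (σ →₀ ℕ)} {d : ℕ} (hS : ∀ a ∈ S, a.degree = d) :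
    minimalExponents (monomialSpan K S) = S := by
  ext a
  simp only [minimalExponents, monomial_mem_monomialSpan, Set.mem_ofPred_eq]
  constructor
  · rintro ⟨⟨b, hb, hba⟩, hmin⟩
    rwa [le_antisymm (hmin ⟨b, hb, le_rfl⟩ hba) hba]
  · intro ha
    refine ⟨⟨a, ha, le_rfl⟩, ?_⟩
    rintro b ⟨c, hc, hcb⟩ hba
    rwa [← eq_of_le_of_degree_eq (hcb.trans hba) (by rw [hS c hc, hS a ha])]

end MonomialSpan

/-! ### Ideals of Veronese type -/

section VeroneseType

variable (K : Type*) [Field K]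

open MvPolynomial

theorem veroneseType_anti (m r : ℕ) {h h' : ℕ} (hle : h' ≤ h) :
    veroneseType K m r h ≤ veroneseType K m r h' := by
  refine Ideal.span_le.2 ?_
  rintro _ ⟨a, ⟨ha, har⟩, rfl⟩
  obtain ⟨b, hb, hbd⟩ := Finsupp.exists_le_degree_eq a h' (by rwa [Finsupp.degree_eq_sum, ha])
  exact monomial_mem_monomialSpan.2
    ⟨b, ⟨by rw [← hbd, Finsupp.degree_eq_sum], fun j => (hb j).trans (har j)⟩, hb⟩

/-- An ideal of Veronese type is the product of balanced ideals of Veronese type. -/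
theorem veroneseType_eq_prod (m r : ℕ) {k : ℕ} (hk : 0 < k) (s c : ℕ) :
    veroneseType K m (k * r) c = ∏ l : Fin k, veroneseType K m r (balancedPart k s c l) := by
  simp only [veroneseType]
  rw [prod_monomialSpan]
  congr 1
  ext a
  constructor
  · rintro ⟨rfl, ha⟩
    obtain ⟨b, hb, hba, hbs⟩ := exists_balanced_decomposition hk r s a ha
    refine ⟨fun l => Finsupp.equivFunOnFinite.symm (b l), fun l => ⟨?_, fun j => ?_⟩, ?_⟩
    · simpa using hbs l
    · simpa using hb l j
    · ext j
      rw [Finsupp.finsetSum_apply]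
      simpa using hba j
  · rintro ⟨b, hb, rfl⟩
    refine ⟨?_, fun j => ?_⟩
    · simp only [Finsupp.finsetSum_apply]
      rw [Finset.sum_comm]
      simp only [fun l => (hb l).1]
      exact sum_balancedPart hk s c
    · rw [Finsupp.finsetSum_apply]
      refine (Finset.sum_le_card_nsmul _ _ r fun l _ => (hb l).2 j).trans ?_
      simp

theorem extendBlock_prod {n : ℕ} (m : Fin n → ℕ) (i : Fin n) {ι : Type*} [Fintype ι]
    (J : ι → Ideal (MvPolynomial (Fin (m i)) K)) :
    extendBlock m i (∏ l, J l) = ∏ l, extendBlock m i (J l) :=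
  map_prod (Ideal.mapHom _) J Finset.univ

theorem extendBlock_monomialSpan {n : ℕ} (m : Fin n → ℕ) (i : Fin n)
    (S : Set (Fin (m i) →₀ ℕ)) :
    extendBlock m i (monomialSpan K S) = monomialSpan K (Finsupp.mapDomain (Sigma.mk i) '' S) := by
  rw [extendBlock, monomialSpan, Ideal.map_span, Set.image_image, monomialSpan, Set.image_image]
  simp only [rename_monomial]

/-- The exponent vectors with entries at most `r` and with prescribed block degrees. -/
def blockVectors {n : ℕ} (m : Fin n → ℕ) (r : ℕ) (c : Fin n →₀ ℕ) :
    Set (((i : Fin n) × Fin (m i)) →₀ ℕ) :=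
  {a | (∀ i, ∑ j, a ⟨i, j⟩ = c i) ∧ ∀ x, a x ≤ r}

theorem extendBlock_mul_extendBlock (m : Fin 2 → ℕ) (r : ℕ) (c : Fin 2 →₀ ℕ) :
    extendBlock m 0 (veroneseType K (m 0) r (c 0)) *
      extendBlock m 1 (veroneseType K (m 1) r (c 1)) = monomialSpan K (blockVectors m r c) := by
  rw [veroneseType, veroneseType, extendBlock_monomialSpan, extendBlock_monomialSpan,
    monomialSpan_mul]
  congr 1
  have hself (i : Fin 2) (a : Fin (m i) →₀ ℕ) (j : Fin (m i)) :
      Finsupp.mapDomain (Sigma.mk (β := fun i => Fin (m i)) i) a ⟨i, j⟩ = a j :=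
    Finsupp.mapDomain_apply (sigma_mk_injective (β := fun i => Fin (m i)) (i := i)) a j
  have hother (i i' : Fin 2) (h : i ≠ i') (a : Fin (m i) →₀ ℕ) (j : Fin (m i')) :
      Finsupp.mapDomain (Sigma.mk (β := fun i => Fin (m i)) i) a ⟨i', j⟩ = 0 :=
    Finsupp.mapDomain_of_notMem_range _ _ (by rintro ⟨x, hx⟩; exact h (congrArg Sigma.fst hx))
  ext a
  constructor
  · rintro ⟨_, ⟨b, hb, rfl⟩, _, ⟨b', hb', rfl⟩, rfl⟩
    refine ⟨fun i => ?_, fun ⟨i, j⟩ => ?_⟩ <;>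
      fin_cases i <;>
      simp [hself, hother, hb.1, hb'.1, hb.2, hb'.2]
  · rintro ⟨ha, har⟩
    refine ⟨_, ⟨Finsupp.equivFunOnFinite.symm fun j => a ⟨0, j⟩, ⟨?_, fun j => ?_⟩, rfl⟩,
      _, ⟨Finsupp.equivFunOnFinite.symm fun j => a ⟨1, j⟩, ⟨?_, fun j => ?_⟩, rfl⟩, ?_⟩
    · simpa using ha 0
    · simpa using har _
    · simpa using ha 1
    · simpa using har _
    · ext ⟨i, j⟩
      fin_cases i <;> simp [hself, hother]

theorem sum_blockVectors_mem {n : ℕ} {m : Fin n → ℕ} {r k : ℕ} {h : Fin k → Fin n →₀ ℕ}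
    {a : Fin k → ((i : Fin n) × Fin (m i)) →₀ ℕ} (ha : ∀ l, a l ∈ blockVectors m r (h l)) :
    ∑ l, a l ∈ blockVectors m (k * r) (∑ l, h l) := by
  refine ⟨fun i => ?_, fun x => ?_⟩
  · simp only [Finsupp.finsetSum_apply]
    rw [Finset.sum_comm]
    exact Finset.sum_congr rfl fun l _ => (ha l).1 i
  · rw [Finsupp.finsetSum_apply]
    refine (Finset.sum_le_card_nsmul _ _ r fun l _ => (ha l).2 x).trans ?_
    simp

end VeroneseType

/-! ### Exponents of the powers of the inducing ideal -/

section DegreePairs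

theorem degree_of_mem_degreePairs {m : Fin 2 → ℕ} {d : ℕ} {h : Fin 2 →₀ ℕ}
    (hh : h ∈ degreePairs m d) : h.degree = d := by
  rw [Finsupp.degree_eq_sum, Fin.sum_univ_two, hh.2]

/-- The `l`-th of `k` balanced summands of `c`. -/
noncomputable def balancedPair (k : ℕ) (c : Fin 2 →₀ ℕ) (l : ℕ) : Fin 2 →₀ ℕ :=
  Finsupp.equivFunOnFinite.symm ![balancedPart k 0 (c 0) l, balancedPart k (c 0) (c 1) l]

/-- The offset from which `balancedPair` splits the `i`-th coordinate. -/
def balancedOffset (c : Fin 2 →₀ ℕ) : Fin 2 → ℕ := ![0, c 0]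

theorem balancedPair_apply (k : ℕ) (c : Fin 2 →₀ ℕ) (l : ℕ) (i : Fin 2) :
    balancedPair k c l i = balancedPart k (balancedOffset c i) (c i) l := by
  fin_cases i <;> rfl

theorem sum_balancedPair {k : ℕ} (hk : 0 < k) (c : Fin 2 →₀ ℕ) :
    ∑ l : Fin k, balancedPair k c l = c := by
  ext i
  simp only [Finsupp.finsetSum_apply, balancedPair_apply]
  exact sum_balancedPart hk _ _

/-- The second coordinate is dealt from where the first stopped, so together they form a run of
length `k * d`, of which each share is exactly `d`. -/
theorem balancedPair_mem {m : Fin 2 → ℕ} {d k : ℕ} (hk : 0 < k) {c : Fin 2 →₀ ℕ}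
    (hc : ∀ i, k ≤ c i ∧ c i ≤ k * (2 * m i)) (hcd : c 0 + c 1 = k * d) (l : ℕ) :
    balancedPair k c l ∈ degreePairs m d := by
  refine ⟨fun i => ?_, ?_⟩
  · rw [balancedPair_apply]
    exact ⟨le_balancedPart hk (by simpa using (hc i).1) _ _, balancedPart_le hk (hc i).2 _ _⟩
  · have h := balancedPart_add k 0 (c 0) (c 1) l
    rw [zero_add, hcd] at h
    refine h.symm.trans (le_antisymm (balancedPart_le hk le_rfl _ _) (le_balancedPart hk le_rfl _ _))

theorem mem_sumset_degreePairs {m : Fin 2 → ℕ} {d k : ℕ} (hk : 0 < k) {c : Fin 2 →₀ ℕ} :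
    c ∈ sumset (fun _ : Fin k => degreePairs m d) ↔
      (∀ i, k ≤ c i ∧ c i ≤ k * (2 * m i)) ∧ c 0 + c 1 = k * d := by
  constructor
  · rintro ⟨a, ha, rfl⟩
    refine ⟨fun i => ⟨?_, ?_⟩, ?_⟩ <;> simp only [Finsupp.finsetSum_apply]
    · simpa using Finset.card_nsmul_le_sum Finset.univ _ 1 fun l _ => ((ha l).1 i).1
    · simpa using Finset.sum_le_card_nsmul Finset.univ _ _ fun l _ => ((ha l).1 i).2
    · rw [← Finset.sum_add_distrib, Finset.sum_congr rfl fun l _ => (ha l).2]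
      simp
  · rintro ⟨hc, hcd⟩
    exact ⟨fun l => balancedPair k c l, fun l => balancedPair_mem hk hc hcd l,
      sum_balancedPair hk c⟩

theorem degree_of_mem_sumset_degreePairs {m : Fin 2 → ℕ} {d k : ℕ} {c : Fin 2 →₀ ℕ}
    (hc : c ∈ sumset fun _ : Fin k => degreePairs m d) : c.degree = k * d := by
  obtain ⟨a, ha, rfl⟩ := hc
  rw [map_sum, Finset.sum_congr rfl fun l _ => degree_of_mem_degreePairs (ha l)]
  simp

end DegreePairs

/-! ### Exchange property of the generators of the power -/

section PowerVectors

variable {n : ℕ}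

/-- The exponent vectors of degree `d` with entries at most `r` and all block degrees at least
`q`. -/
def powerVectors (m : Fin n → ℕ) (r q d : ℕ) : Set (((i : Fin n) × Fin (m i)) →₀ ℕ) :=
  {a | a.degree = d ∧ (∀ x, a x ≤ r) ∧ ∀ i, q ≤ ∑ j, a ⟨i, j⟩}

theorem powerVectors_finite (m : Fin n → ℕ) (r q d : ℕ) : (powerVectors m r q d).Finite :=
  (Set.finite_Iic (Finsupp.equivFunOnFinite.symm fun _ => r)).subset fun _ ha x => ha.2.1 x

theorem exists_lt_of_sum_le {ι : Type*} {s : Finset ι} {f g : ι → ℕ}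
    (h : ∑ i ∈ s, f i ≤ ∑ i ∈ s, g i) {i : ι} (hi : i ∈ s) (hgf : g i < f i) :
    ∃ j ∈ s, f j < g j := by
  by_contra! hcon
  exact (Finset.sum_lt_sum hcon ⟨i, hi, hgf⟩).not_ge h

/-- Removing a unit can only violate the lower bound on its own block. With slack there, any `y`
with `a y < b y` will do; if the bound is tight, the block degree of `b` is no smaller, and `y` is
found in the same block. -/
theorem powerVectors_exchange {m : Fin n → ℕ} {r q d : ℕ}
    {a b : ((i : Fin n) × Fin (m i)) →₀ ℕ} (ha : a ∈ powerVectors m r q d)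
    (hb : b ∈ powerVectors m r q d) {x : (i : Fin n) × Fin (m i)} (hx : b x < a x) :
    ∃ y, a y < b y ∧ a - Finsupp.single x 1 + Finsupp.single y 1 ∈ powerVectors m r q d := by
  obtain ⟨i, j⟩ := x
  obtain ⟨y, hy, hyi⟩ : ∃ y, a y < b y ∧ (y.1 = i ∨ q < ∑ j, a ⟨i, j⟩) := by
    by_cases hq : q < ∑ j, a ⟨i, j⟩
    · obtain ⟨y, -, hy⟩ := exists_lt_of_sum_le (s := Finset.univ) (f := a) (g := b)
        (by rw [← Finsupp.degree_eq_sum, ← Finsupp.degree_eq_sum, ha.1, hb.1])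
        (Finset.mem_univ _) hx
      exact ⟨y, hy, Or.inr hq⟩
    · obtain ⟨j', -, hj'⟩ := exists_lt_of_sum_le (s := Finset.univ) (f := fun j => a ⟨i, j⟩)
        (g := fun j => b ⟨i, j⟩) ((not_lt.1 hq).trans (hb.2.2 i)) (Finset.mem_univ j) hx
      exact ⟨⟨i, j'⟩, hj', Or.inl rfl⟩
  obtain ⟨c, rfl⟩ : ∃ c, a = c + Finsupp.single ⟨i, j⟩ 1 :=
    ⟨a - Finsupp.single ⟨i, j⟩ 1, (tsub_add_cancel_of_le (by
      rw [Finsupp.single_le_iff]; omega)).symm⟩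
  refine ⟨y, hy, ?_⟩
  rw [add_tsub_cancel_right]
  have hblock (y : (i : Fin n) × Fin (m i)) (i' : Fin n) :
      ∑ j', (c + Finsupp.single y 1 : ((i : Fin n) × Fin (m i)) →₀ ℕ) ⟨i', j'⟩ =
        ∑ j', c ⟨i', j'⟩ + if y.1 = i' then 1 else 0 := by
    classical
    simp only [Finsupp.add_apply, Finset.sum_add_distrib]
    congr 1
    obtain ⟨i₀, j₀⟩ := y
    split_ifs with h
    · subst h
      simp [Finsupp.single_apply]
    · exact Finset.sum_eq_zero fun j' _ => Finsupp.single_eq_of_ne fun h' =>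
        h (congrArg Sigma.fst h').symm
  obtain ⟨had, har, haq⟩ := ha
  refine ⟨?_, fun z => ?_, fun i' => ?_⟩
  · rw [map_add, Finsupp.degree_single] at had ⊢
    exact had
  · by_cases hz : z = y
    · subst hz
      have h1 := hb.2.1 z
      rw [Finsupp.add_apply] at hy ⊢
      rw [Finsupp.single_eq_same]
      omega
    · have h1 := har z
      rw [Finsupp.add_apply] at h1 ⊢
      rw [Finsupp.single_eq_of_ne hz]
      omega
  · have h1 := haq i'
    rw [hblock] at h1 ⊢
    rw [hblock, if_pos rfl] at hyi
    dsimp only at h1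
    by_cases hi : i = i'
    · subst hi
      rw [if_pos rfl] at h1
      rcases hyi with h | h
      · rwa [if_pos h]
      · omega
    · rw [if_neg hi] at h1
      omega

theorem hasLinearResolution_powerVectors (K : Type*) [Field K] (m : Fin n → ℕ) (r q d : ℕ) :
    HasLinearResolution d (monomialSpan K (powerVectors m r q d)) := by
  classical
  -- Exchange holds for all coordinates, so any ordering of the variables serves.
  let _ : LinearOrder ((i : Fin n) × Fin (m i)) :=
    LinearOrder.lift' (Fintype.equivFin _) (Fintype.equivFin _).injective
  have hS : HasLexLinearQuotients (powerVectors_finite m r q d).toFinset :=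
    hasLexLinearQuotients_of_exchange fun a ha b hb x hx => by
      rw [Set.Finite.mem_toFinset] at ha hb
      simp only [Set.Finite.mem_toFinset]
      exact powerVectors_exchange ha hb hx
  have h := hS.hasLinearResolution (K := K) (d := d) fun a ha =>
    ((powerVectors_finite m r q d).mem_toFinset.1 ha).1
  rwa [Set.Finite.coe_toFinset] at h

/-- The upper bounds on block degrees follow from the bound `k * 2` on the entries; only the lower
bounds are real conditions. -/
theorem mem_powerVectors_iff {m : Fin 2 → ℕ} {d k : ℕ} (hk : 0 < k)
    {a : ((i : Fin 2) × Fin (m i)) →₀ ℕ} :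
    a ∈ powerVectors m (k * 2) k (k * d) ↔
      a ∈ ⋃ c ∈ sumset (fun _ : Fin k => degreePairs m d), blockVectors m (k * 2) c := by
  have hdeg : a.degree = ∑ j, a ⟨0, j⟩ + ∑ j, a ⟨1, j⟩ := by
    rw [Finsupp.degree_eq_sum, Fintype.sum_sigma, Fin.sum_univ_two]
  simp only [Set.mem_iUnion, exists_prop, mem_sumset_degreePairs hk]
  constructor
  · rintro ⟨had, har, haq⟩
    refine ⟨Finsupp.equivFunOnFinite.symm fun i => ∑ j, a ⟨i, j⟩, ⟨fun i => ⟨haq i, ?_⟩, ?_⟩,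
      fun i => rfl, har⟩
    · change ∑ j, a ⟨i, j⟩ ≤ _
      refine (Finset.sum_le_card_nsmul _ _ (k * 2) fun j _ => har _).trans (le_of_eq ?_)
      rw [Finset.card_univ, Fintype.card_fin, smul_eq_mul]
      ring
    · exact hdeg.symm.trans had
  · rintro ⟨c, ⟨hc, hcd⟩, hac, har⟩
    exact ⟨by rw [hdeg, hac, hac, hcd], har, fun i => (hac i).symm ▸ (hc i).1⟩

end PowerVectors

/-! ### Powers of the mixed product ideal -/

section VeroneseMixedIdeal

variable (K : Type*) [Field K] (m : Fin 2 → ℕ) (d : ℕ)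

theorem veroneseMixedIdeal_eq_monomialSpan :
    veroneseMixedIdeal K m d = monomialSpan K (⋃ h ∈ degreePairs m d, blockVectors m 2 h) := by
  simp only [veroneseMixedIdeal, extendBlock_mul_extendBlock, monomialSpan_biUnion]

theorem inducingIdeal_pow (k : ℕ) :
    inducingIdeal K m d ^ k = monomialSpan K (sumset fun _ : Fin k => degreePairs m d) :=
  monomialSpan_pow _ _

theorem minimalExponents_inducingIdeal :
    minimalExponents (inducingIdeal K m d) = degreePairs m d :=
  minimalExponents_monomialSpan fun _ => degree_of_mem_degreePairs

theorem minimalExponents_inducingIdeal_pow (k : ℕ) :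
    minimalExponents (inducingIdeal K m d ^ k) = sumset fun _ : Fin k => degreePairs m d := by
  rw [inducingIdeal_pow]
  exact minimalExponents_monomialSpan fun _ => degree_of_mem_sumset_degreePairs

theorem veroneseType_eq_prod_balancedPair {k : ℕ} (hk : 0 < k) (c : Fin 2 →₀ ℕ) (i : Fin 2) :
    veroneseType K (m i) (k * 2) (c i) =
      ∏ l : Fin k, veroneseType K (m i) 2 (balancedPair k c l i) := by
  simp only [balancedPair_apply]
  exact veroneseType_eq_prod K (m i) 2 hk _ _

theorem veroneseMixedIdeal_pow {k : ℕ} (hk : 0 < k) :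
    veroneseMixedIdeal K m d ^ k = ⨆ c ∈ sumset (fun _ : Fin k => degreePairs m d),
      extendBlock m 0 (veroneseType K (m 0) (k * 2) (c 0)) *
        extendBlock m 1 (veroneseType K (m 1) (k * 2) (c 1)) := by
  apply le_antisymm
  · rw [veroneseMixedIdeal_eq_monomialSpan, monomialSpan_pow]
    simp only [extendBlock_mul_extendBlock]
    rw [← monomialSpan_biUnion]
    refine monomialSpan_mono ?_
    rintro _ ⟨a, ha, rfl⟩
    simp only [Set.mem_iUnion, exists_prop] at ha ⊢
    choose h hh hah using ha
    exact ⟨∑ l, h l, ⟨h, hh, rfl⟩, sum_blockVectors_mem hah⟩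
  · refine iSup₂_le fun c hc => ?_
    obtain ⟨hc, hcd⟩ := (mem_sumset_degreePairs hk).1 hc
    -- Pairing the `l`-th factors of the two blocks gives one summand of `L` for every `l`.
    rw [veroneseType_eq_prod_balancedPair K m hk c 0, veroneseType_eq_prod_balancedPair K m hk c 1,
      extendBlock_prod, extendBlock_prod, ← Finset.prod_mul_distrib]
    refine (Finset.prod_le_prod' (g := fun _ => veroneseMixedIdeal K m d) fun l _ => ?_).trans ?_
    · exact le_iSup₂_of_le (balancedPair k c l) (balancedPair_mem hk hc hcd l) le_rfl
    · rw [Finset.prod_const, Finset.card_univ, Fintype.card_fin]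

theorem veroneseMixedIdeal_pow_eq_monomialSpan {k : ℕ} (hk : 0 < k) :
    veroneseMixedIdeal K m d ^ k = monomialSpan K (powerVectors m (k * 2) k (k * d)) := by
  rw [veroneseMixedIdeal_pow K m d hk]
  simp only [extendBlock_mul_extendBlock]
  rw [← monomialSpan_biUnion]
  congr 1
  ext a
  exact (mem_powerVectors_iff hk).symm

end VeroneseMixedIdeal

theorem theorem2 (K : Type*) [Field K] (m : Fin 2 → ℕ) (hm : ∀ i, 1 < m i) (d : ℕ)
    (hd : 2 ≤ d) (hd' : d ≤ 2 * m 0 + 2 * m 1 - 1) (k : ℕ) (hk : 1 ≤ k) :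
    HasLinearResolution (k * d) (veroneseMixedIdeal K m d ^ k) ∧
    ∃ F : ∀ i : Fin 2, ℕ → Ideal (MvPolynomial (Fin (m i)) K),
      (∀ c ∈ minimalExponents (inducingIdeal K m d ^ k),
        ∃ a : Fin k → (Fin 2 →₀ ℕ), (∀ l, a l ∈ minimalExponents (inducingIdeal K m d)) ∧
          ∑ l, a l = c ∧ ∀ i, F i (c i) = ∏ l, veroneseType K (m i) 2 (a l i)) ∧
      IsGeneralizedMixedProduct m (inducingIdeal K m d ^ k) F (veroneseMixedIdeal K m d ^ k) := by
  refine ⟨?_, fun i h => veroneseType K (m i) (k * 2) h, fun c hc => ?_, ?_⟩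
  · rw [veroneseMixedIdeal_pow_eq_monomialSpan K m d hk]
    exact hasLinearResolution_powerVectors K m _ _ _
  · rw [minimalExponents_inducingIdeal_pow] at hc
    obtain ⟨hc, hcd⟩ := (mem_sumset_degreePairs hk).1 hc
    rw [minimalExponents_inducingIdeal]
    exact ⟨fun l => balancedPair k c l, fun l => balancedPair_mem hk hc hcd l,
      sum_balancedPair hk c, fun i => veroneseType_eq_prod_balancedPair K m hk c i⟩
  · refine ⟨⟨_, inducingIdeal_pow K m d k⟩, fun htop => ?_, fun a _ i => ⟨_, rfl⟩,
      fun a _ b _ i hba => veroneseType_anti K _ _ hba, ?_⟩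
    · have h1 : MvPolynomial.monomial 0 (1 : K) ∈ inducingIdeal K m d ^ k :=
        htop ▸ Submodule.mem_top
      rw [inducingIdeal_pow, monomial_mem_monomialSpan] at h1
      obtain ⟨c, hc, hc0⟩ := h1
      have h2 := degree_of_mem_sumset_degreePairs hc
      rw [nonpos_iff_eq_zero.1 hc0, map_zero] at h2
      exact (Nat.mul_pos hk (by omega : 0 < d)).ne h2
    · rw [minimalExponents_inducingIdeal_pow, veroneseMixedIdeal_pow K m d hk]
      simp only [Fin.prod_univ_two]
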